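/- Let $X_n$ be the random number of comparisons made by Quicksort (with uniformly random pivots) when sorting $n$ distinct numbers: no comparisons are made for $n=0$; for $n\ge 1$ a uniformly random pivot is compared with the $n-1$ other numbers, and the numbers smaller than the pivot and those larger than the pivot are then sorted recursively and independently. Let $\mu_n=\mathbf E X_n$ and $Y_n=(X_n-\mu_n)/n$ for $n\ge1$. Let $Y$ be the limiting Quicksort variable, i.e. a real random variable with $Y_n\to Y$ in distribution, and let $\phi(t)=\mathbf E e^{itY}$, $t\in\mathbf R$, be its characteristic function. For every real $p\ge 0$ there is a smallest constant $0<c_p<\infty$ such that $$|\phi(t)|\le c_p|t|^{-p}\qquad\text{for all } t\in\mathbf R$$ (where $|t|^{-p}=\infty$ for $t=0$, $p>0$, and $|t|^{-0}=1$). These best possible constants satisfy $$c_0=1,\quad c_{1/2}\le 2,\quad c_{3/4}\le\sqrt{8\pi},\quad c_1\le 4\pi,\quad c_{3/2}<187,\quad c_{5/2}<103215,\quad c_{7/2}<197102280,$$ and the relations $$c_{p_1}^{1/p_1}\le c_{p_2}^{1/p_2}\qquad (0<p_1\le p_2),$$ $$c_{p+1}\le 2^{p+1}\,c_p^{1+1/p}\,\frac{p}{p-1}\qquad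 (p>1),$$ $$c_p\le 2^{p^2+6p}\qquad (p>0).$$ -/

import Mathlib

open MeasureTheory ProbabilityTheory Filter Topology

noncomputable section

namespace Quicksort

/-- The law of the number of comparisons made by `Quicksort` on an array whose (distinct) entries
form the finite set `s`. With nothing to sort, no comparison is made. Otherwise a pivot is picked
uniformly at random from `s`, the other `s.card - 1` entries are compared to it, and the algorithm
is run, with independent randomness, on the entries below and on the entries above the pivot.
(For a one-element array this makes `0` comparisons.) -/
def comparisonsLaw (s : Finset ℕ) : PMF ℕ :=
  if h : s.Nonempty then
    haveI : Nonempty s := h.to_subtype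
    (PMF.uniformOfFintype s).bind fun pivot =>
      (comparisonsLaw (s.filter (· < pivot.1))).bind fun a =>
        (comparisonsLaw (s.filter (pivot.1 < ·))).bind fun b =>
          PMF.pure (s.card - 1 + a + b)
  else PMF.pure 0
termination_by s.card
decreasing_by
  · exact Finset.card_lt_card
      (Finset.filter_ssubset.2 ⟨pivot.1, pivot.2, lt_irrefl _⟩)
  · exact Finset.card_lt_card
      (Finset.filter_ssubset.2 ⟨pivot.1, pivot.2, lt_irrefl _⟩)

/-- The law, on `ℕ`, of the number `X_n` of comparisons required to sort `n` numbers
(the law depends on the array only through its size). -/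
def law (n : ℕ) : Measure ℕ := (comparisonsLaw (Finset.range n)).toMeasure

instance (n : ℕ) : IsProbabilityMeasure (law n) := by
  unfold law; infer_instance

/-- The mean `μ_n = E X_n`. -/
def mean (n : ℕ) : ℝ := ∫ k, (k : ℝ) ∂(law n)

/-- The standardized variate `Y_n = (X_n - μ_n) / n`, as a random variable on the probability
space `(ℕ, law n)`, on which `X_n` is the identity. Only `n ≥ 1` is meaningful. -/
def standardized (n : ℕ) (k : ℕ) : ℝ := ((k : ℝ) - mean n) / n

/-- `Y` is a limiting Quicksort variable: `Y_n → Y` in distribution. -/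
def IsLimit {Ω : Type*} [MeasurableSpace Ω] (P : Measure Ω) [IsProbabilityMeasure P]
    (Y : Ω → ℝ) : Prop :=
  TendstoInDistribution standardized atTop Y law P

/-- The constants `C` with `|φ(t)| ≤ C |t|^{-p}` for all real `t`. For `t = 0` and `p > 0` the
right-hand side is infinite and nothing is required; for `t = 0` and `p = 0` one has `|t|^{-p} = 1`. -/
def decayConstants (φ : ℝ → ℂ) (p : ℝ) : Set ℝ :=
  {C | ∀ t : ℝ, t ≠ 0 ∨ p = 0 → ‖φ t‖ ≤ C * |t| ^ (-p)}

end Quicksort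

end

/-! ### Law, mean and characteristic function of the number of comparisons -/

namespace Quicksort

/-! Conditioning on the rank of the first pivot gives a recursion for the characteristic function of
`X_n - μ_n`. Letting `n → ∞` yields `φ(t) = ∫₀¹ φ(ut) φ((1-u)t) exp(i t g(u)) du` with `g =
limitToll` (`IsLimit.charFun_eq`). Everything else follows from this identity.

With the two values of `φ` written as expectations over independent copies `y, z` of `Y`, `φ(t)` is
an average of oscillatory integrals whose phase has second derivative `2/u + 2/(1-u) ≥ 8`. A van der
Corput estimate, uniform in `y, z`, gives `|φ(t)| ≤ 2 t^(-1/2)`.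

Taking absolute values instead, `f = |φ|` satisfies `f(t) ≤ ∫₀¹ f(ut) f((1-u)t) du`, which improves
any decay already known. An exponent `p < 1` doubles, at the cost of a Beta integral
(`decayBound_two_mul`); an exponent `p > 1` gains one (`decayBound_add_one`). The ladder is 1/2 → 1,
then 3/4 as a geometric mean, 3/4 → 3/2, and unit steps from there. Since `f ≤ 1`, intermediate
exponents follow by interpolation (`DecayBound.of_le`). -/

theorem comparisonsLaw_empty : comparisonsLaw ∅ = PMF.pure 0 := by
  rw [comparisonsLaw]; simp

theorem comparisonsLaw_of_nonempty {s : Finset ℕ} (h : s.Nonempty) [Nonempty s] :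
    comparisonsLaw s = (PMF.uniformOfFintype s).bind fun pivot =>
      (comparisonsLaw (s.filter (· < pivot.1))).bind fun a =>
        (comparisonsLaw (s.filter (pivot.1 < ·))).bind fun b =>
          PMF.pure (s.card - 1 + a + b) := by
  rw [comparisonsLaw, dif_pos h]

theorem uniformOfFintype_bind_equiv {α β γ : Type*} [Fintype α] [Nonempty α] [Fintype β]
    [Nonempty β] (e : β ≃ α) (f : α → PMF γ) :
    (PMF.uniformOfFintype α).bind f = (PMF.uniformOfFintype β).bind (f ∘ e) := by
  ext x
  simp only [PMF.bind_apply, PMF.uniformOfFintype_apply, Function.comp]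
  rw [← e.tsum_eq, Fintype.card_congr e]

theorem card_filter_lt_orderIsoOfFin {s : Finset ℕ} {n : ℕ} (h : s.card = n) (j : Fin n) :
    (s.filter (· < (s.orderIsoOfFin h j : ℕ))).card = j := by
  have : s.filter (· < (s.orderIsoOfFin h j : ℕ)) =
      (Finset.univ.filter (· < j)).map (s.orderEmbOfFin h).toEmbedding := by
    ext x
    simp only [Finset.mem_filter, Finset.mem_map, Finset.mem_univ, true_and]
    constructor
    · rintro ⟨hx, hlt⟩
      refine ⟨(s.orderIsoOfFin h).symm ⟨x, hx⟩, ?_, ?_⟩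
      · rw [OrderIso.symm_apply_lt]; exact hlt
      · change ((s.orderIsoOfFin h) ((s.orderIsoOfFin h).symm ⟨x, hx⟩) : ℕ) = x
        simp
    · rintro ⟨i, hi, rfl⟩
      exact ⟨(s.orderIsoOfFin h i).2, (s.orderIsoOfFin h).lt_iff_lt.2 hi⟩
  rw [this, Finset.card_map, ← Fin.card_Iio j]
  congr 1
  ext i
  simp

theorem card_filter_gt_orderIsoOfFin {s : Finset ℕ} {n : ℕ} (h : s.card = n + 1)
    (j : Fin (n + 1)) :
    (s.filter ((s.orderIsoOfFin h j : ℕ) < ·)).card = n - j := by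
  have h1 := card_filter_lt_orderIsoOfFin h j
  set p : ℕ := (s.orderIsoOfFin h j : ℕ) with hp
  have hps : p ∈ s := (s.orderIsoOfFin h j).2
  have h2 : (s.filter (· < p)).card + (s.filter (¬ · < p)).card = s.card :=
    Finset.card_filter_add_card_filter_not _
  have h3 : s.filter (¬ · < p) = insert p (s.filter (p < ·)) := by
    ext x
    simp only [Finset.mem_filter, Finset.mem_insert]
    constructor
    · rintro ⟨hx, hlt⟩
      rcases (not_lt.1 hlt).eq_or_lt with rfl | h'
      · exact Or.inl rfl
      · exact Or.inr ⟨hx, h'⟩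
    · rintro (rfl | ⟨hx, hlt⟩)
      · exact ⟨hps, lt_irrefl _⟩
      · exact ⟨hx, hlt.le.not_gt⟩
  rw [h3, Finset.card_insert_of_notMem (by simp)] at h2
  omega

/-- The increasing enumeration of `s` turns a uniform pivot into a uniform rank. The induction
hypothesis is an argument, so the same unfolding applies to `s` and to `Finset.range (n + 1)`. -/
theorem comparisonsLaw_eq_bind_of_forall_lt {n : ℕ}
    (ih : ∀ s : Finset ℕ, s.card < n + 1 → comparisonsLaw s = comparisonsLaw (Finset.range s.card))
    {s : Finset ℕ} (hs : s.card = n + 1) :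
    comparisonsLaw s = (PMF.uniformOfFintype (Fin (n + 1))).bind fun j =>
      (comparisonsLaw (Finset.range j)).bind fun a =>
        (comparisonsLaw (Finset.range (n - j))).bind fun b => PMF.pure (n + a + b) := by
  have hne : s.Nonempty := Finset.card_pos.1 (by omega)
  have : Nonempty s := hne.to_subtype
  rw [comparisonsLaw_of_nonempty hne, uniformOfFintype_bind_equiv (s.orderIsoOfFin hs).toEquiv]
  congr 1
  funext j
  have h1 := card_filter_lt_orderIsoOfFin hs j
  have h2 := card_filter_gt_orderIsoOfFin hs j
  have hj := j.2
  simp only [Function.comp, RelIso.coe_fn_toEquiv]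
  rw [ih _ (by rw [h1]; omega), ih (s.filter (_ < ·)) (by rw [h2]; omega), h1, h2, hs]
  rfl

theorem comparisonsLaw_eq_range (s : Finset ℕ) :
    comparisonsLaw s = comparisonsLaw (Finset.range s.card) := by
  induction hN : s.card using Nat.strong_induction_on generalizing s with
  | _ N ih =>
    cases N with
    | zero => rw [Finset.card_eq_zero.1 hN]; simp
    | succ n =>
      have ih' : ∀ s : Finset ℕ, s.card < n + 1 →
        comparisonsLaw s = comparisonsLaw (Finset.range s.card) := fun s hs => ih _ hs s rfl
      rw [comparisonsLaw_eq_bind_of_forall_lt ih' hN,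
        comparisonsLaw_eq_bind_of_forall_lt ih' (Finset.card_range (n + 1))]

theorem comparisonsLaw_range_succ (n : ℕ) :
    comparisonsLaw (Finset.range (n + 1)) = (PMF.uniformOfFintype (Fin (n + 1))).bind fun j =>
      (comparisonsLaw (Finset.range j)).bind fun a =>
        (comparisonsLaw (Finset.range (n - j))).bind fun b => PMF.pure (n + a + b) :=
  comparisonsLaw_eq_bind_of_forall_lt (fun s _ => comparisonsLaw_eq_range s) (Finset.card_range _)

theorem toMeasure_bind_bind_pure (p q : PMF ℕ) (f : ℕ → ℕ → ℕ) :
    (p.bind fun a => q.bind fun b => PMF.pure (f a b)).toMeasure =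
      (p.toMeasure.prod q.toMeasure).map (fun x => f x.1 x.2) := by
  ext s hs
  have hf : Measurable fun x : ℕ × ℕ => f x.1 x.2 := measurable_of_countable _
  rw [Measure.map_apply hf hs, Measure.prod_apply (hf hs), lintegral_countable',
    PMF.toMeasure_bind_apply _ _ _ hs]
  refine tsum_congr fun a => ?_
  rw [PMF.toMeasure_apply_singleton _ _ (measurableSet_singleton _), mul_comm]
  congr 1
  have : (q.bind fun b => PMF.pure (f a b)) = q.map (f a) := rfl
  rw [this, ← PMF.toMeasure_map (f a) q (measurable_of_countable _),
    Measure.map_apply (measurable_of_countable _) hs]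
  rfl

theorem law_zero : law 0 = Measure.dirac 0 := by
  rw [law, Finset.range_zero, comparisonsLaw_empty, PMF.toMeasure_pure]

theorem law_succ (n : ℕ) :
    law (n + 1) = ∑ j : Fin (n + 1), ((n + 1 : ℕ) : ENNReal)⁻¹ •
      ((law j).prod (law (n - j))).map (fun x => n + x.1 + x.2) := by
  ext s hs
  rw [law, comparisonsLaw_range_succ, PMF.toMeasure_bind_apply _ _ _ hs, tsum_fintype,
    Measure.finsetSum_apply]
  refine Finset.sum_congr rfl fun j _ => ?_
  rw [toMeasure_bind_bind_pure _ _ (fun a b => n + a + b), PMF.uniformOfFintype_apply,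
    Fintype.card_fin]
  rfl

theorem integral_law_succ {E : Type*} [NormedAddCommGroup E] [NormedSpace ℝ E] (n : ℕ)
    (f : ℕ → E)
    (hf : ∀ j : Fin (n + 1), Integrable (fun x : ℕ × ℕ => f (n + x.1 + x.2))
      ((law j).prod (law (n - j)))) :
    ∫ k, f k ∂(law (n + 1)) = (n + 1 : ℝ)⁻¹ • ∑ j : Fin (n + 1),
      ∫ x, f (n + x.1 + x.2) ∂((law j).prod (law (n - j))) := by
  rw [law_succ, integral_finsetSum_measure, Finset.smul_sum]
  · refine Finset.sum_congr rfl fun j _ => ?_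
    rw [integral_smul_measure, integral_map (measurable_of_countable _).aemeasurable
      AEStronglyMeasurable.of_discrete]
    simp [ENNReal.toReal_add]
  · intro j _
    refine Integrable.smul_measure ?_ (by simp)
    rw [integrable_map_measure AEStronglyMeasurable.of_discrete
      (measurable_of_countable _).aemeasurable]
    exact hf j

theorem integrable_add_prod {μ ν : Measure ℕ} [IsProbabilityMeasure μ] [IsProbabilityMeasure ν]
    (n : ℕ) (hμ : Integrable (fun k : ℕ => (k : ℝ)) μ) (hν : Integrable (fun k : ℕ => (k : ℝ)) ν) :
    Integrable (fun x : ℕ × ℕ => ((n + x.1 + x.2 : ℕ) : ℝ)) (μ.prod ν) := by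
  simp only [Nat.cast_add]
  exact ((integrable_const _).add (hμ.comp_fst ν)).add (hν.comp_snd μ)

theorem integrable_law (n : ℕ) : Integrable (fun k : ℕ => (k : ℝ)) (law n) := by
  induction n using Nat.strong_induction_on with
  | _ N ih =>
    cases N with
    | zero => rw [law_zero]; exact integrable_dirac (by simp)
    | succ n =>
      rw [law_succ, integrable_finsetSum_measure]
      intro j _
      refine Integrable.smul_measure ?_ (by simp)
      rw [integrable_map_measure AEStronglyMeasurable.of_discrete
        (measurable_of_countable _).aemeasurable]
      exact integrable_add_prod n (ih _ j.2) (ih _ (by omega))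

theorem mean_zero : mean 0 = 0 := by simp [mean, law_zero]

theorem mean_succ (n : ℕ) :
    mean (n + 1) = n + (n + 1 : ℝ)⁻¹ * ∑ j ∈ Finset.range (n + 1), (mean j + mean (n - j)) := by
  have key (j : Fin (n + 1)) : ∫ x, ((n + x.1 + x.2 : ℕ) : ℝ) ∂((law j).prod (law (n - j))) =
      n + (mean j + mean (n - j)) := by
    have h1 := (integrable_law j).comp_fst (law (n - j))
    have h2 := (integrable_law (n - j)).comp_snd (law j)
    simp only [Nat.cast_add]
    have e1 : ∫ x : ℕ × ℕ, (x.1 : ℝ) ∂((law j).prod (law (n - j))) = mean j := by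
      rw [integral_fun_fst (f := fun k : ℕ => (k : ℝ))]; simp [mean]
    have e2 : ∫ x : ℕ × ℕ, (x.2 : ℝ) ∂((law j).prod (law (n - j))) = mean (n - j) := by
      rw [integral_fun_snd (f := fun k : ℕ => (k : ℝ))]; simp [mean]
    rw [integral_add (f := fun x : ℕ × ℕ => (n : ℝ) + x.1) ((integrable_const _).add h1) h2,
      integral_add (integrable_const _) h1, e1, e2]
    simp [add_assoc]
  rw [mean, integral_law_succ _ _ fun j => integrable_add_prod n (integrable_law _)
    (integrable_law _)]
  simp only [key]
  rw [Finset.sum_add_distrib, ← Fin.sum_univ_eq_sum_range (fun j => mean j + mean (n - j))]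
  simp only [Finset.sum_const, Finset.card_univ, Fintype.card_fin, smul_eq_mul, nsmul_eq_mul,
    Nat.cast_add, Nat.cast_one]
  field_simp

theorem sum_range_harmonic_mean (n : ℕ) :
    ∑ j ∈ Finset.range (n + 1), (2 * ((j : ℝ) + 1) * harmonic j - 4 * j) =
      (n + 1) * (2 * ((n : ℝ) + 2) * harmonic (n + 1) - 4 * (n + 1) - n) / 2 := by
  induction n with
  | zero => norm_num [harmonic_succ]
  | succ n ih =>
    rw [Finset.sum_range_succ, ih, harmonic_succ (n + 1)]
    push_cast
    field_simp
    ring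

/-- The exact value is what makes the limit of `toll` computable. -/
theorem mean_eq (n : ℕ) : mean n = 2 * ((n : ℝ) + 1) * harmonic n - 4 * n := by
  induction n using Nat.strong_induction_on with
  | _ N ih =>
    cases N with
    | zero => simp [mean_zero]
    | succ n =>
      rw [mean_succ, Finset.sum_add_distrib]
      have h : ∑ j ∈ Finset.range (n + 1), mean (n - j) = ∑ j ∈ Finset.range (n + 1), mean j := by
        simpa using Finset.sum_range_reflect (fun j => mean j) (n + 1)
      rw [h, Finset.sum_congr rfl fun j hj => ih j (Finset.mem_range.1 hj),
        sum_range_harmonic_mean]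
      push_cast
      field_simp
      ring

/-- The characteristic function of the centred number of comparisons. -/
noncomputable def centredCharFun (n : ℕ) (t : ℝ) : ℂ :=
  ∫ k : ℕ, Complex.exp ((t * (k - mean n) : ℝ) * Complex.I) ∂(law n)

/-- The centred and normalised cost of splitting `n + 1` numbers at a pivot of rank `j` (from `0`). -/
noncomputable def toll (n j : ℕ) : ℝ :=
  (n + mean j + mean (n - j) - mean (n + 1)) / (n + 1)

/-- Given the pivot's rank, the two recursive costs are independent, so their transforms multiply;
the deterministic cost and the recentring go into the last exponential. -/
theorem centredCharFun_succ (n : ℕ) (t : ℝ) :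
    centredCharFun (n + 1) t = (n + 1 : ℝ)⁻¹ • ∑ j ∈ Finset.range (n + 1),
      centredCharFun j t * centredCharFun (n - j) t *
        Complex.exp (((t * (n + 1)) * toll n j : ℝ) * Complex.I) := by
  rw [centredCharFun, integral_law_succ, ← Fin.sum_univ_eq_sum_range (fun j =>
    centredCharFun j t * centredCharFun (n - j) t *
        Complex.exp (((t * (n + 1)) * toll n j : ℝ) * Complex.I))]
  · congr 1
    refine Finset.sum_congr rfl fun j _ => ?_
    rw [centredCharFun, centredCharFun, ← integral_prod_mul, ← integral_mul_const]
    congr 1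
    funext x
    rw [← Complex.exp_add, ← Complex.exp_add, ← add_mul, ← add_mul, ← Complex.ofReal_add,
      ← Complex.ofReal_add]
    congr 3
    have : (n + 1 : ℝ) ≠ 0 := by positivity
    rw [toll]
    push_cast
    field_simp
    ring
  · intro j
    refine Integrable.of_bound AEStronglyMeasurable.of_discrete 1 ?_
    exact .of_forall fun x => by rw [Complex.norm_exp_ofReal_mul_I]

theorem centredCharFun_zero (t : ℝ) : centredCharFun 0 t = 1 := by
  simp [centredCharFun, law_zero, mean_zero]

theorem measurable_standardized (n : ℕ) : Measurable (standardized n) := measurable_of_countable _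

theorem charFun_standardized (n : ℕ) (t : ℝ) :
    charFun ((law n).map (standardized n)) t = centredCharFun n (t / n) := by
  rw [charFun_apply_real, integral_map (measurable_standardized n).aemeasurable
    (by fun_prop), centredCharFun]
  congr 1
  funext k
  rw [standardized]
  congr 2
  push_cast
  ring

theorem centredCharFun_eq_charFun (n : ℕ) (t : ℝ) :
    centredCharFun n t = charFun ((law n).map (standardized n)) (n * t) := by
  rw [charFun_standardized]
  rcases eq_or_ne n 0 with rfl | hn
  · simp [centredCharFun_zero]
  · rw [mul_div_cancel_left₀ _ (by exact_mod_cast hn)]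

end Quicksort

/-! ### Passage to the limit: the functional equation -/

namespace Quicksort

/-- The modulus of continuity is bounded by the integral of a bounded continuous function, a
quantity that weak convergence controls. -/
theorem norm_charFun_sub_le (μ : Measure ℝ) [IsProbabilityMeasure μ] {s t δ : ℝ}
    (h : |s - t| ≤ δ) : ‖charFun μ s - charFun μ t‖ ≤ ∫ x, min 2 (δ * |x|) ∂μ := by
  have hi (u : ℝ) : Integrable (fun x : ℝ => Complex.exp (u * x * Complex.I)) μ := by
    refine Integrable.of_bound (by fun_prop) 1 (.of_forall fun x => ?_)
    rw [← Complex.ofReal_mul, Complex.norm_exp_ofReal_mul_I]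
  rw [charFun_apply_real, charFun_apply_real, ← integral_sub (hi s) (hi t)]
  have hδ : 0 ≤ δ := (abs_nonneg _).trans h
  refine norm_integral_le_of_norm_le (Integrable.of_bound (by fun_prop) 2
    (.of_forall fun x => ?_)) (.of_forall fun x => le_min ?_ ?_)
  · rw [Real.norm_of_nonneg (by positivity)]; exact min_le_left _ _
  · refine (norm_sub_le _ _).trans ?_
    rw [← Complex.ofReal_mul, Complex.norm_exp_ofReal_mul_I, ← Complex.ofReal_mul,
      Complex.norm_exp_ofReal_mul_I]
    norm_num
  · have e : Complex.exp (s * x * Complex.I) - Complex.exp (t * x * Complex.I) =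
        Complex.exp ((t * x : ℝ) * Complex.I) *
          (Complex.exp (Complex.I * ((s - t) * x : ℝ)) - 1) := by
      rw [mul_sub, ← Complex.exp_add, mul_one]
      push_cast
      congr 2
      ring
    rw [e, norm_mul, Complex.norm_exp_ofReal_mul_I, one_mul]
    refine Real.norm_exp_I_mul_ofReal_sub_one_le.trans ?_
    rw [Real.norm_eq_abs, abs_mul]
    gcongr

theorem tendsto_integral_min_two_mul_abs (μ : Measure ℝ) [IsProbabilityMeasure μ] :
    Tendsto (fun δ : ℝ => ∫ x, min 2 (δ * |x|) ∂μ) (𝓝[>] 0) (𝓝 0) := by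
  have : ∫ x, min 2 ((0 : ℝ) * |x|) ∂μ = 0 := by simp
  nth_rewrite 3 [← this]
  refine tendsto_integral_filter_of_dominated_convergence (fun _ => 2)
    (.of_forall fun δ => by fun_prop) ?_ (integrable_const _) (.of_forall fun x => ?_)
  · filter_upwards [self_mem_nhdsWithin] with δ hδ
    refine .of_forall fun x => ?_
    rw [Real.norm_of_nonneg (le_min zero_le_two (mul_nonneg (le_of_lt hδ) (abs_nonneg _)))]
    exact min_le_left _ _
  · have hc : Continuous fun δ : ℝ => min 2 (δ * |x|) := by fun_prop
    exact tendsto_nhdsWithin_of_tendsto_nhds (hc.tendsto 0)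

/-- Weak convergence implies locally uniform convergence of the characteristic functions. -/
theorem tendsto_charFun_prod {ν : ℕ → ProbabilityMeasure ℝ} {μ : ProbabilityMeasure ℝ}
    (h : Tendsto ν atTop (𝓝 μ)) (s : ℝ) :
    Tendsto (fun q : ℕ × ℝ => charFun (ν q.1 : Measure ℝ) q.2) (atTop ×ˢ 𝓝 s)
      (𝓝 (charFun (μ : Measure ℝ) s)) := by
  have h1 : Tendsto (fun q : ℕ × ℝ => charFun (ν q.1 : Measure ℝ) s) (atTop ×ˢ 𝓝 s)
      (𝓝 (charFun (μ : Measure ℝ) s)) :=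
    (ProbabilityMeasure.tendsto_iff_tendsto_charFun.1 h s).comp tendsto_fst
  refine h1.congr_dist ?_
  rw [Metric.tendsto_nhds]
  intro ε hε
  obtain ⟨δ, hδε, hδ⟩ := (((tendsto_integral_min_two_mul_abs (μ : Measure ℝ)).eventually
    (gt_mem_nhds hε)).and self_mem_nhdsWithin).exists
  have hδ : 0 < δ := hδ
  let f : BoundedContinuousFunction ℝ ℝ := BoundedContinuousFunction.ofNormedAddCommGroup
    (fun x => min 2 (δ * |x|)) (by fun_prop) 2 fun x => by
      rw [Real.norm_of_nonneg (by positivity)]; exact min_le_left _ _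
  have h2 : ∀ᶠ n in atTop, ∫ x, f x ∂(ν n : Measure ℝ) < ε :=
    (ProbabilityMeasure.tendsto_iff_forall_integral_tendsto.1 h f).eventually (gt_mem_nhds hδε)
  have h3 : ∀ᶠ u in 𝓝 s, |s - u| ≤ δ := by
    filter_upwards [Metric.closedBall_mem_nhds s hδ] with u hu
    rw [abs_sub_comm]; exact hu
  filter_upwards [h2.prod_mk h3] with q hq
  rw [Real.dist_0_eq_abs, abs_of_nonneg dist_nonneg, dist_eq_norm]
  exact (norm_charFun_sub_le _ hq.2).trans_lt hq.1

/-- Rewrites the average over pivot ranks as an integral over a fixed interval, so that dominated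
convergence applies. -/
theorem intervalIntegral_floor {E : Type*} [NormedAddCommGroup E] [NormedSpace ℝ E]
    [CompleteSpace E] (a : ℕ → E) {N : ℕ} (hN : N ≠ 0) :
    ∫ u in (0 : ℝ)..1, a ⌊(N : ℝ) * u⌋₊ = (N : ℝ)⁻¹ • ∑ j ∈ Finset.range N, a j := by
  have hN' : (N : ℝ) ≠ 0 := by exact_mod_cast hN
  rw [intervalIntegral.integral_comp_mul_left (fun v => a ⌊v⌋₊) hN', mul_zero, mul_one]
  have hae (j : ℕ) : ∀ᵐ v : ℝ, v ∈ Set.uIoc (j : ℝ) (j + 1 : ℕ) → a ⌊v⌋₊ = a j := by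
    filter_upwards [compl_mem_ae_iff.2 (measure_singleton ((j : ℝ) + 1))] with v hv hmem
    rw [Set.uIoc_of_le (by simp)] at hmem
    have : ⌊v⌋₊ = j := by
      rw [Nat.floor_eq_iff ((Nat.cast_nonneg j).trans hmem.1.le)]
      refine ⟨hmem.1.le, lt_of_le_of_ne ?_ hv⟩
      simpa using hmem.2
    rw [this]
  have hint (j : ℕ) : ∫ v in (j : ℝ)..(j + 1 : ℕ), a ⌊v⌋₊ = a j := by
    rw [intervalIntegral.integral_congr_ae (hae j), intervalIntegral.integral_const]
    simp
  have hi (j : ℕ) : IntervalIntegrable (fun v : ℝ => a ⌊v⌋₊) volume (j : ℝ) (j + 1 : ℕ) := by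
    refine IntervalIntegrable.congr_ae (f := fun _ => a j) intervalIntegrable_const ?_
    rw [Filter.EventuallyEq, ae_restrict_iff' measurableSet_uIoc]
    filter_upwards [hae j] with v hv hmem
    exact (hv hmem).symm
  have := intervalIntegral.sum_integral_adjacent_intervals (f := fun v : ℝ => a ⌊v⌋₊)
    (μ := volume) (a := fun j : ℕ => (j : ℝ)) (n := N) fun j _ => hi j
  rw [Nat.cast_zero] at this
  rw [← this]
  simp only [hint]

/-- The toll function of the limiting Quicksort recursion. -/
noncomputable def limitToll (u : ℝ) : ℝ :=
  2 * u * Real.log u + 2 * (1 - u) * Real.log (1 - u) + 1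

/-- Only differences of harmonic numbers remain, so the logarithmic growth of the means cancels. -/
theorem toll_eq {n j : ℕ} (hj : j ≤ n) :
    toll n j = 1 + 3 / (n + 1) + 2 * ((j + 1) / (n + 1) * (harmonic j - harmonic (n + 1)) +
      ((n - j : ℕ) + 1) / (n + 1) * (harmonic (n - j) - harmonic (n + 1))) := by
  rw [toll, mean_eq, mean_eq, mean_eq, Nat.cast_sub hj]
  push_cast
  field_simp
  ring

/-- Both harmonic numbers equal a logarithm plus the Euler–Mascheroni constant up to `o(1)`, and the
constant cancels. -/
theorem tendsto_harmonic_sub_harmonic {k : ℕ → ℕ} {a : ℝ} (ha : 0 < a)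
    (hk : Tendsto k atTop atTop)
    (hka : Tendsto (fun n => (k n : ℝ) / (n + 1 : ℕ)) atTop (𝓝 a)) :
    Tendsto (fun n => (harmonic (k n) : ℝ) - harmonic (n + 1)) atTop (𝓝 (Real.log a)) := by
  have h1 := Real.tendsto_harmonic_sub_log.comp hk
  have h2 := Real.tendsto_harmonic_sub_log.comp (tendsto_add_atTop_nat 1)
  have h3 := (h1.sub h2).add (hka.log ha.ne')
  rw [sub_self, zero_add] at h3
  refine h3.congr' ?_
  filter_upwards [hk.eventually_gt_atTop 0] with n hn
  have : (k n : ℝ) ≠ 0 := by exact_mod_cast hn.ne'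
  rw [Real.log_div this (by positivity)]
  simp only [Function.comp]
  ring

theorem tendsto_toll {k : ℕ → ℕ} {u : ℝ} (h0 : 0 < u) (h1 : u < 1) (hle : ∀ n, k n ≤ n)
    (hk : Tendsto k atTop atTop) (hk' : Tendsto (fun n => n - k n) atTop atTop)
    (hku : Tendsto (fun n => (k n : ℝ) / (n + 1 : ℕ)) atTop (𝓝 u))
    (hku' : Tendsto (fun n => ((n - k n : ℕ) : ℝ) / (n + 1 : ℕ)) atTop (𝓝 (1 - u))) :
    Tendsto (fun n => toll n (k n)) atTop (𝓝 (limitToll u)) := by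
  have hinv : Tendsto (fun n : ℕ => 1 / ((n : ℝ) + 1)) atTop (𝓝 0) :=
    tendsto_one_div_add_atTop_nhds_zero_nat
  have e1 := tendsto_harmonic_sub_harmonic h0 hk hku
  have e2 := tendsto_harmonic_sub_harmonic (sub_pos.2 h1) hk' hku'
  have e3 := ((hku.add hinv).mul e1).add ((hku'.add hinv).mul e2)
  have e4 := ((hinv.const_mul 3).const_add 1).add (e3.const_mul 2)
  refine (e4.congr fun n => ?_).trans (le_of_eq ?_)
  · rw [toll_eq (hle n)]
    push_cast
    ring
  · rw [limitToll]
    congr 1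
    ring

theorem measurable_limitToll : Measurable limitToll := by
  unfold limitToll
  fun_prop

/-- The argument of the characteristic function moves with `n`, so pointwise convergence is not
enough; `tendsto_charFun_prod` supplies the local uniformity. -/
theorem IsLimit.tendsto_centredCharFun {Ω : Type*} [MeasurableSpace Ω] {P : Measure Ω}
    [IsProbabilityMeasure P] {Y : Ω → ℝ} (hY : IsLimit P Y) {k : ℕ → ℕ} {u : ℝ}
    (hk : Tendsto k atTop atTop)
    (hku : Tendsto (fun n => (k n : ℝ) / (n + 1 : ℕ)) atTop (𝓝 u)) (t : ℝ) :
    Tendsto (fun n => centredCharFun (k n) (t / (n + 1 : ℕ))) atTop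
      (𝓝 (charFun (P.map Y) (u * t))) := by
  have h := (tendsto_charFun_prod hY.tendsto (u * t)).comp (hk.prodMk (hku.mul_const t))
  refine h.congr fun n => ?_
  rw [centredCharFun_eq_charFun]
  simp only [Function.comp, ProbabilityMeasure.coe_mk]
  congr 1
  ring

theorem norm_centredCharFun_le_one (n : ℕ) (t : ℝ) : ‖centredCharFun n t‖ ≤ 1 := by
  rw [centredCharFun_eq_charFun]
  have := Measure.isProbabilityMeasure_map (μ := law n) (measurable_standardized n).aemeasurable
  exact norm_charFun_le_one _

/-- The functional equation for the characteristic function of the limiting Quicksort law. -/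
theorem IsLimit.charFun_eq {Ω : Type*} [MeasurableSpace Ω] {P : Measure Ω}
    [IsProbabilityMeasure P] {Y : Ω → ℝ} (hY : IsLimit P Y) (t : ℝ) :
    charFun (P.map Y) t = ∫ u in (0 : ℝ)..1, charFun (P.map Y) (u * t) *
      charFun (P.map Y) ((1 - u) * t) * Complex.exp ((t * limitToll u : ℝ) * Complex.I) := by
  let G (n j : ℕ) : ℂ :=
    centredCharFun j (t / (n + 1 : ℕ)) * centredCharFun (n - j) (t / (n + 1 : ℕ)) *
      Complex.exp ((t * toll n j : ℝ) * Complex.I)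
  let F (n : ℕ) (u : ℝ) : ℂ := G n ⌊((n + 1 : ℕ) : ℝ) * u⌋₊
  have hF (n : ℕ) : ∫ u in (0 : ℝ)..1, F n u = centredCharFun (n + 1) (t / (n + 1 : ℕ)) := by
    rw [intervalIntegral_floor (G n) n.succ_ne_zero, centredCharFun_succ]
    have : t / (n + 1 : ℕ) * (n + 1) = t := by
      rw [Nat.cast_add_one]
      exact div_mul_cancel₀ _ (by positivity)
    simp only [G, this]
    simp
  have hlim : Tendsto (fun n => centredCharFun (n + 1) (t / (n + 1 : ℕ))) atTop
      (𝓝 (charFun (P.map Y) (1 * t))) := by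
    refine hY.tendsto_centredCharFun (tendsto_add_atTop_nat 1) ?_ t
    refine tendsto_const_nhds.congr fun n => ?_
    rw [div_self (by positivity)]
  rw [one_mul] at hlim
  refine tendsto_nhds_unique hlim ?_
  simp only [← hF]
  refine intervalIntegral.tendsto_integral_filter_of_dominated_convergence (fun _ => 1)
    (.of_forall fun n => ?_) (.of_forall fun n => .of_forall fun u _ => ?_)
    intervalIntegrable_const ?_
  · have : Measurable fun u : ℝ => ⌊((n + 1 : ℕ) : ℝ) * u⌋₊ :=
      Nat.measurable_floor.comp (measurable_const_mul _)
    exact ((measurable_of_countable (G n)).comp this).aestronglyMeasurable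
  · simp only [F, G, norm_mul, Complex.norm_exp_ofReal_mul_I, mul_one]
    exact mul_le_one₀ (norm_centredCharFun_le_one _ _) (norm_nonneg _)
      (norm_centredCharFun_le_one _ _)
  -- At `u = 1` the floor is `n + 1`, which is not a rank; this null set is dropped.
  · filter_upwards [compl_mem_ae_iff.2 (measure_singleton (1 : ℝ))] with u hu1 hu
    rw [Set.uIoc_of_le zero_le_one] at hu
    have h0 : 0 < u := hu.1
    have h1 : u < 1 := lt_of_le_of_ne hu.2 hu1
    set k : ℕ → ℕ := fun n => ⌊((n + 1 : ℕ) : ℝ) * u⌋₊ with hkdef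
    have hsucc : Tendsto (fun n : ℕ => ((n + 1 : ℕ) : ℝ)) atTop atTop :=
      tendsto_natCast_atTop_atTop.comp (tendsto_add_atTop_nat 1)
    have hku : Tendsto (fun n => (k n : ℝ) / (n + 1 : ℕ)) atTop (𝓝 u) := by
      refine ((tendsto_nat_floor_mul_div_atTop h0.le).comp hsucc).congr fun n => ?_
      simp only [Function.comp, hkdef, mul_comm u]
    have hle (n : ℕ) : k n ≤ n := by
      rw [← Nat.lt_succ_iff, hkdef]
      refine (Nat.floor_lt (by positivity)).2 ?_
      exact mul_lt_of_lt_one_right (by positivity) h1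
    have hku' : Tendsto (fun n => ((n - k n : ℕ) : ℝ) / (n + 1 : ℕ)) atTop (𝓝 (1 - u)) := by
      have hinv : Tendsto (fun n : ℕ => 1 / ((n : ℝ) + 1)) atTop (𝓝 0) :=
        tendsto_one_div_add_atTop_nhds_zero_nat
      have := (hinv.const_sub 1).sub hku
      rw [sub_zero] at this
      refine this.congr fun n => ?_
      rw [Nat.cast_sub (hle n)]
      push_cast
      field_simp
      ring
    have top {m : ℕ → ℕ} {a : ℝ} (ha : 0 < a)
        (hm : Tendsto (fun n => (m n : ℝ) / (n + 1 : ℕ)) atTop (𝓝 a)) : Tendsto m atTop atTop := by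
      rw [← tendsto_natCast_atTop_iff (R := ℝ)]
      refine (hm.pos_mul_atTop ha hsucc).congr fun n => ?_
      rw [div_mul_cancel₀ _ (by positivity)]
    have hk := top h0 hku
    have hk' := top (sub_pos.2 h1) hku'
    refine ((hY.tendsto_centredCharFun hk hku t).mul
      (hY.tendsto_centredCharFun hk' hku' t)).mul ?_
    have hc : Continuous fun x : ℝ => Complex.exp ((t * x : ℝ) * Complex.I) := by fun_prop
    exact (hc.tendsto _).comp (tendsto_toll h0 h1 hle hk hk' hku hku')

end Quicksort

/-! ### Oscillatory integrals and decay of order 1/2 -/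

namespace Quicksort

/-- First derivative test for oscillatory integrals. -/
theorem norm_integral_exp_le_of_deriv_mono {H H' H'' : ℝ → ℝ} {a b : ℝ} (hab : a ≤ b)
    (hH : ∀ u ∈ Set.Icc a b, HasDerivAt H (H' u) u)
    (hH' : ∀ u ∈ Set.Icc a b, HasDerivAt H' (H'' u) u)
    (hH'' : ContinuousOn H'' (Set.Icc a b)) (hnn : ∀ u ∈ Set.Icc a b, 0 ≤ H'' u)
    (hpos : 0 < H' a) :
    ‖∫ u in a..b, Complex.exp (H u * Complex.I)‖ ≤ 2 / H' a := by
  have hIcc : Set.uIcc a b = Set.Icc a b := Set.uIcc_of_le hab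
  have hmono : MonotoneOn H' (Set.Icc a b) := by
    refine monotoneOn_of_deriv_nonneg (convex_Icc a b)
      (fun u hu => (hH' u hu).continuousAt.continuousWithinAt)
      (fun u hu => (hH' u (interior_subset hu)).differentiableAt.differentiableWithinAt)
      fun u hu => ?_
    rw [(hH' u (interior_subset hu)).deriv]
    exact hnn u (interior_subset hu)
  have hpos' : ∀ u ∈ Set.Icc a b, 0 < H' u := fun u hu =>
    hpos.trans_le (hmono (Set.left_mem_Icc.2 hab) hu hu.1)
  have hcH : ContinuousOn H (Set.Icc a b) := fun u hu =>
    (hH u hu).continuousAt.continuousWithinAt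
  have hcH' : ContinuousOn H' (Set.Icc a b) := fun u hu =>
    (hH' u hu).continuousAt.continuousWithinAt
  have hinv : ∀ u ∈ Set.Icc a b, HasDerivAt (fun v => (H' v)⁻¹) (-H'' u / H' u ^ 2) u :=
    fun u hu => (hH' u hu).inv (hpos' u hu).ne'
  have hcq : ContinuousOn (fun u => -H'' u / H' u ^ 2) (Set.Icc a b) :=
    hH''.neg.div (hcH'.pow 2) fun u hu => (pow_pos (hpos' u hu) 2).ne'
  have hcexp : ContinuousOn (fun u => Complex.exp (H u * Complex.I)) (Set.Icc a b) := by
    fun_prop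
  have hexp : ∀ u ∈ Set.uIcc a b, HasDerivAt (fun v => Complex.exp (H v * Complex.I))
      (Complex.exp (H u * Complex.I) * (H' u * Complex.I)) u := fun u hu =>
    ((hH u (hIcc ▸ hu)).ofReal_comp.mul_const Complex.I).cexp
  have hu' : ∀ u ∈ Set.uIcc a b, HasDerivAt (fun v => (((H' v)⁻¹ : ℝ) : ℂ) * (-Complex.I))
      (((-H'' u / H' u ^ 2 : ℝ) : ℂ) * (-Complex.I)) u := fun u hu =>
    (hinv u (hIcc ▸ hu)).ofReal_comp.mul_const _
  have hiq : IntervalIntegrable (fun u => -H'' u / H' u ^ 2) volume a b :=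
    (hcq.mono hIcc.le).intervalIntegrable
  have hparts := intervalIntegral.integral_mul_deriv_eq_deriv_mul hu' hexp
    ((hIcc ▸ (by fun_prop : ContinuousOn (fun u =>
      ((-H'' u / H' u ^ 2 : ℝ) : ℂ) * (-Complex.I)) (Set.Icc a b))).intervalIntegrable)
    ((hIcc ▸ (by fun_prop : ContinuousOn (fun u =>
      Complex.exp (H u * Complex.I) * (H' u * Complex.I)) (Set.Icc a b))).intervalIntegrable)
  -- Multiply and divide by `i H'`, so that one factor is the derivative of the exponential.
  have hlhs : ∫ u in a..b, Complex.exp (H u * Complex.I) =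
      ∫ u in a..b, (((H' u)⁻¹ : ℝ) : ℂ) * (-Complex.I) *
        (Complex.exp (H u * Complex.I) * (H' u * Complex.I)) := by
    refine intervalIntegral.integral_congr fun u hu => ?_
    have : (H' u : ℂ) ≠ 0 := by exact_mod_cast (hpos' u (hIcc ▸ hu)).ne'
    push_cast
    field_simp
    rw [Complex.I_sq]
    ring
  -- Because `H'' ≥ 0`, the norm of the integrand is exactly the derivative of `-1/H'`. With the
  -- boundary terms, the `1/H' b` contributions cancel and `2/H' a` is left.
  have hrest : ‖∫ u in a..b, ((-H'' u / H' u ^ 2 : ℝ) : ℂ) * (-Complex.I) *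
      Complex.exp (H u * Complex.I)‖ ≤ (H' a)⁻¹ - (H' b)⁻¹ := by
    have h1 : ∫ u in a..b, -(-H'' u / H' u ^ 2) = (H' a)⁻¹ - (H' b)⁻¹ := by
      rw [intervalIntegral.integral_neg, intervalIntegral.integral_eq_sub_of_hasDerivAt
        (fun u hu => hinv u (hIcc ▸ hu)) hiq]
      ring
    rw [← h1]
    refine intervalIntegral.norm_integral_le_of_norm_le hab (.of_forall fun u hu => ?_) hiq.neg
    have hu : u ∈ Set.Icc a b := Set.Ioc_subset_Icc_self hu
    rw [norm_mul, norm_mul, Complex.norm_exp_ofReal_mul_I, norm_neg, Complex.norm_I,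
      Complex.norm_real, Real.norm_eq_abs, neg_div, abs_neg, neg_neg, mul_one, mul_one,
      abs_of_nonneg (div_nonneg (hnn u hu) (sq_nonneg _))]
  have hn (u : ℝ) (hu : u ∈ Set.Icc a b) : ‖(((H' u)⁻¹ : ℝ) : ℂ) * (-Complex.I) *
      Complex.exp (H u * Complex.I)‖ = (H' u)⁻¹ := by
    rw [norm_mul, norm_mul, Complex.norm_exp_ofReal_mul_I, norm_neg, Complex.norm_I,
      Complex.norm_real, Real.norm_of_nonneg (inv_nonneg.2 (hpos' u hu).le), mul_one, mul_one]
  rw [hlhs, hparts]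
  refine ((norm_sub_le _ _).trans (add_le_add (norm_sub_le _ _) hrest)).trans (le_of_eq ?_)
  rw [hn a (Set.left_mem_Icc.2 hab), hn b (Set.right_mem_Icc.2 hab)]
  ring

/-- The phase of the oscillatory integral attached to the Quicksort recursion. -/
noncomputable def phase (y z u : ℝ) : ℝ := u * y + (1 - u) * z + limitToll u

theorem phase_one_sub (y z u : ℝ) : phase y z (1 - u) = phase z y u := by
  simp only [phase, limitToll, sub_sub_cancel]
  ring

theorem measurable_phase (y z : ℝ) : Measurable (phase y z) := by
  have := measurable_limitToll
  unfold phase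
  fun_prop

theorem hasDerivAt_phase (y z : ℝ) {u : ℝ} (h0 : 0 < u) (h1 : u < 1) :
    HasDerivAt (phase y z) (y - z + 2 * Real.log u - 2 * Real.log (1 - u)) u := by
  have h1' : 1 - u ≠ 0 := (sub_pos.2 h1).ne'
  have hid := hasDerivAt_id' u
  have hsub := hid.const_sub 1
  have := (((hid.mul_const y).add (hsub.mul_const z)).add
    ((((hid.const_mul 2).mul (hid.log h0.ne')).add
      ((hsub.const_mul 2).mul (hsub.log h1'))).add_const 1))
  refine this.congr_deriv ?_
  field_simp
  ring

theorem hasDerivAt_deriv_phase (y z : ℝ) {u : ℝ} (h0 : 0 < u) (h1 : u < 1) :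
    HasDerivAt (fun u => y - z + 2 * Real.log u - 2 * Real.log (1 - u))
      (2 / u + 2 / (1 - u)) u := by
  have h1' : 1 - u ≠ 0 := (sub_pos.2 h1).ne'
  have hid := hasDerivAt_id' u
  have := (((hid.log h0.ne').const_mul 2).const_add (y - z)).sub
    (((hid.const_sub 1).log h1').const_mul 2)
  refine this.congr_deriv ?_
  field_simp
  ring

theorem intervalIntegrable_exp_phase (t y z a b : ℝ) :
    IntervalIntegrable (fun u => Complex.exp ((t * phase y z u : ℝ) * Complex.I)) volume a b := by
  have := measurable_phase y z
  refine (intervalIntegrable_const (c := (1 : ℝ))).mono_fun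
    (by fun_prop : Measurable _).aestronglyMeasurable (.of_forall fun u => ?_)
  simp only [Complex.norm_exp_ofReal_mul_I]
  simp

/-- The phase derivative is singular at 1, so the derivative test is applied on `[b, x]` and `x`
tends to 1. -/
theorem norm_integral_exp_phase_right_le {t y z b s : ℝ} (ht : 0 < t) (hb0 : 0 < b) (hb1 : b < 1)
    (hs : 0 < s) (hbs : y - z + 2 * Real.log b - 2 * Real.log (1 - b) = s) :
    ‖∫ u in b..1, Complex.exp ((t * phase y z u : ℝ) * Complex.I)‖ ≤ 2 / (t * s) := by
  have hcont : Continuous fun x => ∫ u in b..x, Complex.exp ((t * phase y z u : ℝ) * Complex.I) :=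
    intervalIntegral.continuous_primitive (fun _ _ => intervalIntegrable_exp_phase _ _ _ _ _) b
  have hlim := tendsto_nhdsWithin_of_tendsto_nhds (s := Set.Iio 1) (hcont.norm.tendsto 1)
  refine le_of_tendsto hlim ?_
  filter_upwards [Ioo_mem_nhdsLT hb1] with x hx
  have hmem : ∀ u ∈ Set.Icc b x, 0 < u ∧ u < 1 := fun u hu =>
    ⟨hb0.trans_le hu.1, hu.2.trans_lt hx.2⟩
  have := norm_integral_exp_le_of_deriv_mono (H := fun u => t * phase y z u)
    (H' := fun u => t * (y - z + 2 * Real.log u - 2 * Real.log (1 - u)))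
    (H'' := fun u => t * (2 / u + 2 / (1 - u))) hx.1.le
    (fun u hu => (hasDerivAt_phase y z (hmem u hu).1 (hmem u hu).2).const_mul t)
    (fun u hu => (hasDerivAt_deriv_phase y z (hmem u hu).1 (hmem u hu).2).const_mul t)
    (continuousOn_const.mul ((continuousOn_const.div continuousOn_id fun u hu => (hmem u hu).1.ne').add
      (continuousOn_const.div (continuousOn_const.sub continuousOn_id)
        fun u hu => (sub_pos.2 (hmem u hu).2).ne')))
    (fun u hu => by
      have := (hmem u hu).1
      have := sub_pos.2 (hmem u hu).2
      positivity)
    (by rw [hbs]; positivity)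
  rwa [hbs] at this

theorem sigmoid_sub_sigmoid_le {x y : ℝ} (h : x ≤ y) :
    Real.sigmoid y - Real.sigmoid x ≤ (y - x) / 4 := by
  have hd (u : ℝ) := Real.hasDerivAt_sigmoid u
  have : Real.sigmoid y - Real.sigmoid x ≤ (1 / 4) * (y - x) := by
    refine (convex_univ (𝕜 := ℝ) (E := ℝ)).image_sub_le_mul_sub_of_deriv_le
      (fun u _ => (hd u).continuousAt.continuousWithinAt)
      (fun u _ => (hd u).differentiableAt.differentiableWithinAt) (fun u _ => ?_)
      x trivial y trivial h
    rw [(hd u).deriv]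
    nlinarith [sq_nonneg (2 * Real.sigmoid u - 1)]
  linarith

/-- The sigmoid inverts the logit, hence locates the points where the phase derivative takes a
prescribed value. -/
theorem log_sigmoid_sub_log (x : ℝ) :
    Real.log (Real.sigmoid x) - Real.log (1 - Real.sigmoid x) = x := by
  have hp := Real.sigmoid_pos x
  rw [← Real.sigmoid_neg, ← Real.log_div hp.ne' (Real.sigmoid_pos _).ne']
  rw [Real.sigmoid_def, Real.sigmoid_def, neg_neg]
  have : (1 + Real.exp (-x))⁻¹ / (1 + Real.exp x)⁻¹ = Real.exp x := by
    have := Real.exp_pos x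
    rw [Real.exp_neg]
    field_simp
    ring
  rw [this, Real.log_exp]

/-- Cut where the phase derivative equals `±4r`, with `r = t^(-1/2)`. The middle piece has length at
most `r` since the sigmoid is 1/4-Lipschitz, and each tail contributes at most `2/(4rt) = r/2`. The
factor 4 minimises this sum. -/
theorem norm_integral_exp_phase_le {t : ℝ} (ht : 0 < t) (y z : ℝ) :
    ‖∫ u in (0 : ℝ)..1, Complex.exp ((t * phase y z u : ℝ) * Complex.I)‖ ≤
      2 * t ^ (-(1 / 2) : ℝ) := by
  set r : ℝ := t ^ (-(1 / 2) : ℝ) with hr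
  have hrpos : 0 < r := Real.rpow_pos_of_pos ht _
  have htr : t * r ^ 2 = 1 := by
    rw [hr, ← Real.rpow_natCast, ← Real.rpow_mul ht.le]
    norm_num
    rw [Real.rpow_neg_one, mul_inv_cancel₀ ht.ne']
  set f : ℝ → ℂ := fun u => Complex.exp ((t * phase y z u : ℝ) * Complex.I) with hf
  set a := Real.sigmoid ((-(4 * r) - (y - z)) / 2) with ha
  set b := Real.sigmoid ((4 * r - (y - z)) / 2) with hb
  have ha' := log_sigmoid_sub_log ((-(4 * r) - (y - z)) / 2)
  have hb' := log_sigmoid_sub_log ((4 * r - (y - z)) / 2)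
  rw [← ha] at ha'
  rw [← hb] at hb'
  have hab : b - a ≤ r := by
    have := sigmoid_sub_sigmoid_le
      (show (-(4 * r) - (y - z)) / 2 ≤ (4 * r - (y - z)) / 2 by linarith)
    rw [← ha, ← hb] at this
    linarith
  have hab0 : a ≤ b := Real.sigmoid_monotone (by linarith)
  have hbound : 2 / (t * (4 * r)) = r / 2 := by
    have : t * r * r = 1 := by rw [← htr]; ring
    field_simp
    linarith
  have hright : ‖∫ u in b..1, f u‖ ≤ r / 2 := by
    rw [← hbound]
    exact norm_integral_exp_phase_right_le ht (Real.sigmoid_pos _) (Real.sigmoid_lt_one _)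
      (by positivity) (by linarith)
  -- The reflection `u ↦ 1 - u` exchanges `y` and `z` and turns the left tail into a right tail.
  have hleft : ‖∫ u in (0 : ℝ)..a, f u‖ ≤ r / 2 := by
    have h1 : ∫ u in (0 : ℝ)..a, f u = ∫ u in (1 - a)..1, f (1 - u) := by
      rw [intervalIntegral.integral_comp_sub_left, sub_self, sub_sub_cancel]
    rw [h1, ← hbound]
    simp only [hf, phase_one_sub]
    refine norm_integral_exp_phase_right_le ht (sub_pos.2 (Real.sigmoid_lt_one _))
      (sub_lt_self _ (Real.sigmoid_pos _)) (by positivity) ?_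
    rw [sub_sub_cancel]
    linarith
  have hmid : ‖∫ u in a..b, f u‖ ≤ r := by
    refine (intervalIntegral.norm_integral_le_of_norm_le_const (C := 1) fun u _ => ?_).trans ?_
    · rw [hf, Complex.norm_exp_ofReal_mul_I]
    · rw [one_mul, abs_of_nonneg (sub_nonneg.2 hab0)]
      exact hab
  have hi (a b : ℝ) : IntervalIntegrable f volume a b := intervalIntegrable_exp_phase _ _ _ _ _
  rw [← intervalIntegral.integral_add_adjacent_intervals (hi 0 b) (hi b 1),
    ← intervalIntegral.integral_add_adjacent_intervals (hi 0 a) (hi a b)]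
  refine (norm_add₃_le).trans ?_
  linarith

theorem IsLimit.norm_charFun_le_of_pos {Ω : Type*} [MeasurableSpace Ω] {P : Measure Ω}
    [IsProbabilityMeasure P] {Y : Ω → ℝ} (hY : IsLimit P Y) {t : ℝ} (ht : 0 < t) :
    ‖charFun (P.map Y) t‖ ≤ 2 * t ^ (-(1 / 2) : ℝ) := by
  have := Measure.isProbabilityMeasure_map (μ := P) hY.aemeasurable_limit
  have heq := hY.charFun_eq t
  set μ := P.map Y
  have hmeas : Measurable fun q : ℝ × ℝ × ℝ =>
      Complex.exp ((t * phase q.2.1 q.2.2 q.1 : ℝ) * Complex.I) := by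
    have := measurable_limitToll
    unfold phase
    fun_prop
  have h1 (u : ℝ) : charFun μ (u * t) * charFun μ ((1 - u) * t) *
      Complex.exp ((t * limitToll u : ℝ) * Complex.I) =
      ∫ x, Complex.exp ((t * phase x.1 x.2 u : ℝ) * Complex.I) ∂(μ.prod μ) := by
    rw [charFun_apply_real, charFun_apply_real, ← integral_prod_mul, ← integral_mul_const]
    congr 1
    funext x
    rw [← Complex.exp_add, ← Complex.exp_add, phase]
    push_cast
    ring_nf
  rw [heq]
  simp only [h1]
  rw [intervalIntegral.integral_of_le zero_le_one, integral_integral_swap]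
  · refine (norm_integral_le_of_norm_le_const (C := 2 * t ^ (-(1 / 2) : ℝ))
      (.of_forall fun x => ?_)).trans (by simp)
    rw [← intervalIntegral.integral_of_le zero_le_one]
    exact norm_integral_exp_phase_le ht _ _
  · refine Integrable.of_bound hmeas.aestronglyMeasurable 1 (.of_forall fun q => ?_)
    rw [Function.uncurry, Complex.norm_exp_ofReal_mul_I]

end Quicksort

/-! ### Bootstrapping the decay exponent -/

namespace Quicksort

/-- The properties of the modulus of the Quicksort characteristic function that govern its decay. -/
structure SelfConvolutive (f : ℝ → ℝ) : Prop where
  continuous : Continuous f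
  nonneg : ∀ t, 0 ≤ f t
  le_one : ∀ t, f t ≤ 1
  le_integral : ∀ t, f t ≤ ∫ u in (0 : ℝ)..1, f (u * t) * f ((1 - u) * t)

/-- `f` decays at least as fast as `C * t ^ (-p)` on the positive half-line. -/
def DecayBound (f : ℝ → ℝ) (p C : ℝ) : Prop := ∀ t, 0 < t → f t ≤ C * t ^ (-p)

theorem IsLimit.selfConvolutive {Ω : Type*} [MeasurableSpace Ω] {P : Measure Ω}
    [IsProbabilityMeasure P] {Y : Ω → ℝ} (hY : IsLimit P Y) :
    SelfConvolutive fun t => ‖charFun (P.map Y) t‖ := by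
  have := Measure.isProbabilityMeasure_map (μ := P) hY.aemeasurable_limit
  have hc : Continuous (charFun (P.map Y)) := continuous_charFun
  refine ⟨hc.norm, fun t => norm_nonneg _, fun t => norm_charFun_le_one t, fun t => ?_⟩
  rw [hY.charFun_eq t]
  refine intervalIntegral.norm_integral_le_of_norm_le zero_le_one (.of_forall fun u _ => ?_)
    (Continuous.intervalIntegrable (by fun_prop) _ _)
  rw [norm_mul, Complex.norm_exp_ofReal_mul_I, mul_one, norm_mul]

/-- As `0 ≤ f ≤ 1` and `p/q ≤ 1`, `f ≤ f^(p/q)`. This is the monotonicity of `c_p^(1/p)`. -/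
theorem DecayBound.of_le {f : ℝ → ℝ} {p q C : ℝ} (h0 : ∀ t, 0 ≤ f t) (h1 : ∀ t, f t ≤ 1)
    (hp : 0 < p) (hpq : p ≤ q) (hC : 0 ≤ C) (h : DecayBound f q C) :
    DecayBound f p (C ^ (p / q)) := by
  intro t ht
  have hq : 0 < q := hp.trans_le hpq
  have hpq0 : 0 ≤ p / q := (div_pos hp hq).le
  calc f t = f t ^ (1 : ℝ) := (Real.rpow_one _).symm
    _ ≤ f t ^ (p / q) := by
      rcases (h0 t).eq_or_lt with h | h
      · rw [← h, Real.zero_rpow one_ne_zero]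
        exact Real.rpow_nonneg le_rfl _
      · exact Real.rpow_le_rpow_of_exponent_ge h (h1 t) ((div_le_one hq).2 hpq)
    _ ≤ (C * t ^ (-q)) ^ (p / q) := Real.rpow_le_rpow (h0 t) (h t ht) hpq0
    _ = C ^ (p / q) * t ^ (-p) := by
      rw [Real.mul_rpow hC (Real.rpow_nonneg ht.le _), ← Real.rpow_mul ht.le]
      congr 2
      field_simp

theorem DecayBound.mono {f : ℝ → ℝ} {p C D : ℝ} (h : DecayBound f p C) (hCD : C ≤ D) :
    DecayBound f p D := fun t ht =>
  (h t ht).trans (mul_le_mul_of_nonneg_right hCD (Real.rpow_nonneg ht.le _))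

theorem beta_integrand_eq (p : ℝ) {u : ℝ} (hu : u ∈ Set.Ioc (0 : ℝ) 1) :
    (u : ℂ) ^ (((1 - p : ℝ) : ℂ) - 1) * (1 - (u : ℂ)) ^ (((1 - p : ℝ) : ℂ) - 1) =
      ((u ^ (-p) * (1 - u) ^ (-p) : ℝ) : ℂ) := by
  rw [Complex.ofReal_mul, Complex.ofReal_cpow hu.1.le, Complex.ofReal_cpow (sub_nonneg.2 hu.2)]
  push_cast
  congr 2 <;> ring

theorem intervalIntegrable_rpow_mul_one_sub_rpow {p : ℝ} (hp : p < 1) :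
    IntervalIntegrable (fun u : ℝ => u ^ (-p) * (1 - u) ^ (-p)) volume 0 1 := by
  have h := Complex.betaIntegral_convergent (u := ((1 - p : ℝ) : ℂ)) (v := ((1 - p : ℝ) : ℂ))
    (by simpa using hp) (by simpa using hp)
  rw [intervalIntegrable_iff_integrableOn_Ioc_of_le zero_le_one] at h ⊢
  refine IntegrableOn.congr_fun (f := fun u : ℝ => Complex.re ((u : ℂ) ^ (((1 - p : ℝ) : ℂ) - 1) *
    (1 - (u : ℂ)) ^ (((1 - p : ℝ) : ℂ) - 1))) h.re (fun u hu => ?_) measurableSet_Ioc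
  simp only [beta_integrand_eq p hu, Complex.ofReal_re]

theorem integral_rpow_mul_one_sub_rpow {p : ℝ} (hp : p < 1) :
    ∫ u in (0 : ℝ)..1, u ^ (-p) * (1 - u) ^ (-p) =
      Real.Gamma (1 - p) ^ 2 / Real.Gamma (2 - 2 * p) := by
  have h := beta_eq_betaIntegralReal (1 - p) (1 - p) (sub_pos.2 hp) (sub_pos.2 hp)
  have e : Complex.betaIntegral ((1 - p : ℝ) : ℂ) ((1 - p : ℝ) : ℂ) =
      ((∫ u in (0 : ℝ)..1, u ^ (-p) * (1 - u) ^ (-p) : ℝ) : ℂ) := by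
    rw [Complex.betaIntegral, ← intervalIntegral.integral_ofReal,
      intervalIntegral.integral_of_le zero_le_one, intervalIntegral.integral_of_le zero_le_one]
    exact setIntegral_congr_fun measurableSet_Ioc fun u hu => beta_integrand_eq p hu
  rw [e, Complex.ofReal_re] at h
  rw [← h, ProbabilityTheory.beta]
  ring_nf

/-- Bound both factors by the known decay: `t^(-2p)` comes out, and the remaining integral is the
Beta value `B(1-p, 1-p)`, finite because `p < 1`. -/
theorem SelfConvolutive.decayBound_two_mul {f : ℝ → ℝ} (hf : SelfConvolutive f) {p C : ℝ}
    (hp : p < 1) (hC : 0 ≤ C) (h : DecayBound f p C) :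
    DecayBound f (2 * p) (C ^ 2 * (Real.Gamma (1 - p) ^ 2 / Real.Gamma (2 - 2 * p))) := by
  intro t ht
  have hcf := hf.continuous
  refine (hf.le_integral t).trans ?_
  rw [← integral_rpow_mul_one_sub_rpow hp, mul_right_comm, ← intervalIntegral.integral_const_mul]
  refine intervalIntegral.integral_mono_on_of_le_Ioo zero_le_one
    (Continuous.intervalIntegrable (by fun_prop) _ _)
    ((intervalIntegrable_rpow_mul_one_sub_rpow hp).const_mul _) fun u hu => ?_
  have hu1 : 0 < 1 - u := sub_pos.2 hu.2
  refine (mul_le_mul (h _ (mul_pos hu.1 ht)) (h _ (mul_pos hu1 ht)) (hf.nonneg _)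
    (mul_nonneg hC (Real.rpow_nonneg (mul_pos hu.1 ht).le _))).trans (le_of_eq ?_)
  rw [Real.mul_rpow hu.1.le ht.le, Real.mul_rpow hu1.le ht.le,
    show -(2 * p) = -p + -p by ring, Real.rpow_add ht]
  ring

/-- `A` is the crossover of the two available bounds: `f ≤ 1` is used below it, `(A/v)^p` above it.
-/
theorem SelfConvolutive.integral_le {f : ℝ → ℝ} (hf : SelfConvolutive f) {p A δ T : ℝ}
    (hp : 1 < p) (hA : 0 < A) (h : DecayBound f p (A ^ p)) (hδA : δ ≤ A) (hδT : δ ≤ T) :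
    ∫ v in δ..T, f v ≤ A * p / (p - 1) - δ := by
  have hi (a b : ℝ) : IntervalIntegrable f volume a b := hf.continuous.intervalIntegrable _ _
  have hp1 : 0 < p - 1 := sub_pos.2 hp
  -- Enlarging the upper limit covers the case `T < A`.
  set M := max A T
  have hAM : A ≤ M := le_max_left _ _
  have hM : 0 < M := hA.trans_le hAM
  have h1 : ∫ v in δ..T, f v ≤ ∫ v in δ..M, f v :=
    intervalIntegral.integral_mono_interval le_rfl hδT (le_max_right _ _)
      (.of_forall hf.nonneg) (hi _ _)
  have h2 : ∫ v in δ..A, f v ≤ A - δ := by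
    have := intervalIntegral.integral_mono_on hδA (hi δ A) (intervalIntegrable_const (c := (1 : ℝ)))
      fun v _ => hf.le_one v
    simpa using this
  have hni : (0 : ℝ) ∉ Set.uIcc A M := by
    rw [Set.uIcc_of_le hAM]
    exact fun h => hA.not_ge h.1
  have h3 : ∫ v in A..M, f v ≤ A / (p - 1) := by
    have hint : IntervalIntegrable (fun v : ℝ => A ^ p * v ^ (-p)) volume A M :=
      (intervalIntegral.intervalIntegrable_rpow (Or.inr hni)).const_mul _
    refine (intervalIntegral.integral_mono_on hAM (hi A M) hint
      fun v hv => h v (hA.trans_le hv.1)).trans ?_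
    rw [intervalIntegral.integral_const_mul, integral_rpow (Or.inr ⟨by linarith, hni⟩)]
    have e : A ^ p * A ^ (-p + 1) = A := by
      rw [← Real.rpow_add hA]; norm_num
    have hMp : 0 ≤ A ^ p * M ^ (-p + 1) :=
      mul_nonneg (Real.rpow_nonneg hA.le _) (Real.rpow_nonneg hM.le _)
    rw [← mul_div_assoc, mul_sub, e, show -p + 1 = -(p - 1) by ring, div_neg, ← neg_div, neg_sub]
    rw [show -p + 1 = -(p - 1) by ring] at hMp
    gcongr
    linarith
  have h4 := intervalIntegral.integral_add_adjacent_intervals (hi δ A) (hi A M)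
  have e : A * p / (p - 1) = A + A / (p - 1) := by field_simp; ring
  rw [e]
  linarith

/-- By symmetry it suffices to treat `u ≤ 1/2`, where the decay bound applied at `(1-u)t` gives `2^p
C t^(-p)` and the other factor is integrable. When `ut ≤ δ ≤ t/4`, one has `1 - u ≥ 3/4`, and `2^p`
improves to `(4/3)^p`. -/
theorem SelfConvolutive.le_of_decayBound {f : ℝ → ℝ} (hf : SelfConvolutive f) {p C t δ : ℝ}
    (hp : 1 < p) (hC : 0 < C) (h : DecayBound f p C) (ht : 0 < t) (hδ0 : 0 ≤ δ)
    (hδ : δ ≤ C ^ (1 / p)) (hδt : δ ≤ t / 4) :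
    f t ≤ 2 * C * ((4 / 3) ^ p * δ + 2 ^ p * (C ^ (1 / p) * p / (p - 1) - δ)) *
      t ^ (-(p + 1)) := by
  have hp0 : 0 < p := one_pos.trans hp
  have hcf := hf.continuous
  set A := C ^ (1 / p) with hA
  have hA0 : 0 < A := Real.rpow_pos_of_pos hC _
  have hAp : A ^ p = C := by
    rw [hA, ← Real.rpow_mul hC.le, one_div_mul_cancel hp0.ne', Real.rpow_one]
  set g : ℝ → ℝ := fun u => f (u * t) * f ((1 - u) * t) with hg
  have hgi (a b : ℝ) : IntervalIntegrable g volume a b :=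
    Continuous.intervalIntegrable (by fun_prop) _ _
  set d := δ / t with hd
  have hd0 : 0 ≤ d := by positivity
  have hd4 : d ≤ 1 / 4 := by rw [hd, div_le_iff₀ ht]; linarith
  have hdt : d * t = δ := div_mul_cancel₀ _ ht.ne'
  have hsymm : ∫ u in (1 / 2 : ℝ)..1, g u = ∫ u in (0 : ℝ)..(1 / 2), g u := by
    have : ∫ u in (0 : ℝ)..(1 / 2), g (1 - u) = ∫ u in (1 / 2 : ℝ)..1, g u := by
      rw [intervalIntegral.integral_comp_sub_left]
      norm_num
    rw [← this]
    refine intervalIntegral.integral_congr fun u _ => ?_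
    simp only [hg, sub_sub_cancel, mul_comm]
  have hK (a : ℝ) (ha : 0 < a) {u : ℝ} (hu : a ≤ 1 - u) :
      f ((1 - u) * t) ≤ C * ((1 / a) ^ p * t ^ (-p)) := by
    have h1u : 0 < 1 - u := ha.trans_le hu
    refine (h _ (mul_pos h1u ht)).trans (mul_le_mul_of_nonneg_left ?_ hC.le)
    rw [Real.mul_rpow h1u.le ht.le]
    refine mul_le_mul_of_nonneg_right ?_ (Real.rpow_nonneg ht.le _)
    rw [one_div, Real.inv_rpow ha.le, ← Real.rpow_neg ha.le]
    exact Real.rpow_le_rpow_of_nonpos ha hu (by linarith)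
  have hfirst : ∫ u in (0 : ℝ)..d, g u ≤ d * (C * ((4 / 3) ^ p * t ^ (-p))) := by
    have := intervalIntegral.integral_mono_on hd0 (hgi 0 d)
      (intervalIntegrable_const (c := C * ((4 / 3) ^ p * t ^ (-p)))) fun u hu => by
        have := hK (3 / 4) (by norm_num) (u := u) (by linarith [hu.2])
        norm_num at this
        calc g u ≤ 1 * f ((1 - u) * t) :=
              mul_le_mul_of_nonneg_right (hf.le_one _) (hf.nonneg _)
          _ ≤ _ := by rw [one_mul]; exact this
    rwa [intervalIntegral.integral_const, sub_zero, smul_eq_mul] at this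
  have hsecond : ∫ u in d..(1 / 2), g u ≤
      C * (2 ^ p * t ^ (-p)) * (t⁻¹ * (A * p / (p - 1) - δ)) := by
    have hd2 : d ≤ 1 / 2 := hd4.trans (by norm_num)
    have := intervalIntegral.integral_mono_on hd2 (hgi d (1 / 2))
      (g := fun u => C * (2 ^ p * t ^ (-p)) * f (u * t))
      (Continuous.intervalIntegrable (by fun_prop) _ _) fun u hu => by
        have := hK (1 / 2) (by norm_num) (u := u) (by linarith [hu.2])
        norm_num at this
        calc g u ≤ f (u * t) * (C * (2 ^ p * t ^ (-p))) :=
              mul_le_mul_of_nonneg_left this (hf.nonneg _)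
          _ = _ := mul_comm _ _
    refine this.trans ?_
    rw [intervalIntegral.integral_const_mul, intervalIntegral.integral_comp_mul_right _ ht.ne',
      hdt, smul_eq_mul]
    have hT : δ ≤ 1 / 2 * t := by linarith
    have := hf.integral_le hp hA0 (hAp.symm ▸ h) hδ hT
    gcongr
  have htotal : ∫ u in (0 : ℝ)..1, g u = 2 * ((∫ u in (0 : ℝ)..d, g u) + ∫ u in d..(1 / 2), g u) := by
    rw [intervalIntegral.integral_add_adjacent_intervals (hgi _ _) (hgi _ _), two_mul]
    nth_rewrite 2 [← hsymm]
    rw [intervalIntegral.integral_add_adjacent_intervals (hgi _ _) (hgi _ _)]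
  have hpow : t ^ (-(p + 1)) = t ^ (-p) * t⁻¹ := by
    rw [neg_add, Real.rpow_add ht, Real.rpow_neg_one]
  refine (hf.le_integral t).trans ((htotal.trans_le (mul_le_mul_of_nonneg_left
    (add_le_add hfirst hsecond) zero_le_two)).trans (le_of_eq ?_))
  rw [hpow, hd]
  field_simp

theorem SelfConvolutive.decayBound_add_one {f : ℝ → ℝ} (hf : SelfConvolutive f) {p C : ℝ}
    (hp : 1 < p) (hC : 0 < C) (h : DecayBound f p C) :
    DecayBound f (p + 1) (2 ^ (p + 1) * C ^ (1 + 1 / p) * p / (p - 1)) := by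
  intro t ht
  refine (hf.le_of_decayBound hp hC h ht le_rfl (Real.rpow_nonneg hC.le _)
    (by positivity)).trans (le_of_eq ?_)
  rw [Real.rpow_add hC, Real.rpow_add two_pos, Real.rpow_one, Real.rpow_one]
  ring

theorem Gamma_natCast_add {s : ℝ} (hs : 0 < s) (n : ℕ) :
    Real.Gamma (n + s) = (∏ i ∈ Finset.range n, (i + s)) * Real.Gamma s := by
  induction n with
  | zero => simp
  | succ n ih =>
    rw [Finset.prod_range_succ, Nat.cast_add_one, add_right_comm,
      Real.Gamma_add_one (by positivity), ih]
    ring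

/-- Log-convexity gives `Γ(30 + 1/4)² ≤ Γ(30) Γ(30 + 1/2)`, and the functional equation brings this
down to `Γ(1/4)² / Γ(1/2)`. The shift 30 makes the loss small enough; `8 * 7.4375 = 59.5` and `59.5
π < 187`. -/
theorem eight_pi_mul_Gamma_lt :
    8 * Real.pi * (Real.Gamma (1 / 4) ^ 2 / Real.Gamma (1 / 2)) < 187 := by
  have hconv := Real.Gamma_mul_add_mul_le_rpow_Gamma_mul_rpow_Gamma
    (s := (30 : ℕ)) (t := (30 : ℕ) + 1 / 2) (a := 1 / 2) (b := 1 / 2) (by norm_num) (by norm_num)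
    (by norm_num) (by norm_num) (by norm_num)
  have hg1 : 0 < Real.Gamma (30 : ℕ) := Real.Gamma_pos_of_pos (by norm_num)
  have hg2 : 0 < Real.Gamma ((30 : ℕ) + 1 / 2) := Real.Gamma_pos_of_pos (by norm_num)
  have hg3 : 0 < Real.Gamma (1 / 2) := Real.Gamma_pos_of_pos (by norm_num)
  rw [← Real.sqrt_eq_rpow, ← Real.sqrt_eq_rpow, ← Real.sqrt_mul hg1.le,
    show (1 / 2 * (30 : ℕ) + 1 / 2 * ((30 : ℕ) + 1 / 2) : ℝ) = (30 : ℕ) + 1 / 4 by norm_num] at hconv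
  have hsq := (Real.le_sqrt' (Real.Gamma_pos_of_pos (by norm_num))).1 hconv
  rw [Gamma_natCast_add (by norm_num), Gamma_natCast_add (by norm_num),
    show Real.Gamma (30 : ℕ) = (29 : ℕ).factorial by
      rw [← Real.Gamma_nat_eq_factorial]; norm_num] at hsq
  have hpi : Real.pi < 3.1416 := Real.pi_lt_d4
  rw [mul_pow, ← mul_assoc] at hsq
  have hq : Real.Gamma (1 / 4) ^ 2 / Real.Gamma (1 / 2) ≤
      ((29 : ℕ).factorial * ∏ i ∈ Finset.range 30, ((i : ℝ) + 1 / 2)) /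
        (∏ i ∈ Finset.range 30, ((i : ℝ) + 1 / 4)) ^ 2 := by
    rw [div_le_div_iff₀ hg3 (by positivity)]
    linarith
  have hnum : ((29 : ℕ).factorial * ∏ i ∈ Finset.range 30, ((i : ℝ) + 1 / 2)) /
        (∏ i ∈ Finset.range 30, ((i : ℝ) + 1 / 4)) ^ 2 ≤ 7.4375 := by
    simp only [Finset.prod_range_succ, Finset.prod_range_zero, Nat.factorial]
    norm_num
  have hpos := Real.pi_pos
  calc 8 * Real.pi * (Real.Gamma (1 / 4) ^ 2 / Real.Gamma (1 / 2))
      ≤ 8 * Real.pi * 7.4375 := by gcongr; exact hq.trans hnum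
    _ < 187 := by nlinarith

end Quicksort

/-! ### Explicit constants and best constants -/

namespace Quicksort

theorem SelfConvolutive.decayBound_one {f : ℝ → ℝ} (hf : SelfConvolutive f)
    (h : DecayBound f (1 / 2) 2) : DecayBound f 1 (4 * Real.pi) := by
  have := hf.decayBound_two_mul (by norm_num) zero_le_two h
  norm_num [Real.Gamma_one_half_eq, Real.sq_sqrt Real.pi_pos.le] at this
  exact this

/-- Geometric mean of the bounds of orders 1/2 and 1. Order 1 itself fits neither bootstrap, whereas
3/4 doubles to an exponent beyond 1. -/
theorem SelfConvolutive.decayBound_three_quarters {f : ℝ → ℝ} (hf : SelfConvolutive f)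
    (h : DecayBound f (1 / 2) 2) : DecayBound f (3 / 4) √(8 * Real.pi) := by
  intro t ht
  have h1 := h t ht
  have h2 := hf.decayBound_one h t ht
  have hr : 0 ≤ t ^ (-(3 / 4) : ℝ) := Real.rpow_nonneg ht.le _
  refine (sq_le_sq₀ (hf.nonneg t) (by positivity)).1 ?_
  have e : (t ^ (-(3 / 4) : ℝ)) ^ 2 = t ^ (-(1 / 2) : ℝ) * t ^ (-1 : ℝ) := by
    rw [← Real.rpow_natCast, ← Real.rpow_mul ht.le, ← Real.rpow_add ht]
    norm_num
  rw [mul_pow, Real.sq_sqrt (by positivity), e, pow_two]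
  refine (mul_le_mul h1 h2 (hf.nonneg t) (by positivity)).trans (le_of_eq ?_)
  ring

theorem SelfConvolutive.exists_decayBound_three_halves {f : ℝ → ℝ} (hf : SelfConvolutive f)
    (h : DecayBound f (1 / 2) 2) : ∃ C < 187, DecayBound f (3 / 2) C := by
  refine ⟨_, eight_pi_mul_Gamma_lt, ?_⟩
  have := hf.decayBound_two_mul (by norm_num) (Real.sqrt_nonneg _) (hf.decayBound_three_quarters h)
  rw [Real.sq_sqrt (by positivity)] at this
  norm_num at this ⊢
  exact this

/-- Starting from 187, the plain step `δ = 0` would give about 103770, too much for the claimed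
103215. For `t ≤ 100` the bound is trivial since `100^(5/2) = 10^5`; for `t ≥ 100`, the choice `δ =
25` is admissible and saves enough. -/
theorem SelfConvolutive.decayBound_five_halves {f : ℝ → ℝ} (hf : SelfConvolutive f)
    (h : DecayBound f (1 / 2) 2) : DecayBound f (5 / 2) (10 ^ 5) := by
  obtain ⟨C, hC, h3⟩ := hf.exists_decayBound_three_halves h
  have h187 : DecayBound f (3 / 2) 187 := h3.mono hC.le
  intro t ht
  rcases le_total t 100 with h100 | h100
  · refine (hf.le_one t).trans ?_
    have : (100 : ℝ) ^ (-(5 / 2) : ℝ) ≤ t ^ (-(5 / 2) : ℝ) :=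
      Real.rpow_le_rpow_of_nonpos ht h100 (by norm_num)
    have e : (100 : ℝ) ^ (-(5 / 2) : ℝ) = (10 ^ 5)⁻¹ := by
      rw [show (100 : ℝ) = 10 ^ (2 : ℝ) by norm_num, ← Real.rpow_mul (by norm_num)]
      norm_num
    rw [e] at this
    linarith
  · have hA : (187 : ℝ) ^ (1 / (3 / 2) : ℝ) ≤ 32.8 := by
      rw [← Real.rpow_le_rpow_iff (z := 3 / 2) (by positivity) (by norm_num) (by norm_num),
        ← Real.rpow_mul (by norm_num)]
      norm_num
      rw [show (3 / 2 : ℝ) = 3 * (1 / 2) by norm_num, Real.rpow_mul (by norm_num),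
        ← Real.sqrt_eq_rpow]
      refine Real.le_sqrt_of_sq_le ?_
      norm_num
    have hA' : (25 : ℝ) ≤ (187 : ℝ) ^ (1 / (3 / 2) : ℝ) := by
      rw [← Real.rpow_le_rpow_iff (z := 3 / 2) (by positivity) (by positivity) (by norm_num),
        ← Real.rpow_mul (by norm_num)]
      norm_num
    have h1 : (4 / 3 : ℝ) ^ (3 / 2 : ℝ) ≤ 1.54 := by
      rw [show (3 / 2 : ℝ) = 3 * (1 / 2) by norm_num, Real.rpow_mul (by norm_num),
        ← Real.sqrt_eq_rpow]
      refine Real.sqrt_le_iff.2 ⟨by norm_num, ?_⟩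
      norm_num
    have h2 : (2 : ℝ) ^ (3 / 2 : ℝ) ≤ 2.83 := by
      rw [show (3 / 2 : ℝ) = 3 * (1 / 2) by norm_num, Real.rpow_mul (by norm_num),
        ← Real.sqrt_eq_rpow]
      refine Real.sqrt_le_iff.2 ⟨by norm_num, ?_⟩
      norm_num
    have := hf.le_of_decayBound (by norm_num) (by norm_num) h187 ht (δ := 25) (by norm_num) hA'
      (by linarith)
    rw [show (-(3 / 2 + 1) : ℝ) = -(5 / 2) by norm_num] at this
    refine this.trans (mul_le_mul_of_nonneg_right ?_ (Real.rpow_nonneg ht.le _))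
    generalize (187 : ℝ) ^ (1 / (3 / 2) : ℝ) = A at hA hA' ⊢
    generalize (4 / 3 : ℝ) ^ (3 / 2 : ℝ) = x at h1 ⊢
    generalize (2 : ℝ) ^ (3 / 2 : ℝ) = y at h2 ⊢
    rw [show A * (3 / 2) / (3 / 2 - 1) = 3 * A by norm_num; ring]
    have h3 : y * (3 * A - 25) ≤ 2.83 * 73.4 :=
      mul_le_mul h2 (by linarith) (by linarith) (by norm_num)
    linarith

theorem SelfConvolutive.decayBound_seven_halves {f : ℝ → ℝ} (hf : SelfConvolutive f)
    (h : DecayBound f (1 / 2) 2) : DecayBound f (7 / 2) 190000000 := by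
  have := hf.decayBound_add_one (by norm_num) (by norm_num) (hf.decayBound_five_halves h)
  rw [show (5 / 2 + 1 : ℝ) = 7 / 2 by norm_num] at this
  refine this.mono ?_
  have e : ((10 : ℝ) ^ 5) ^ (1 + 1 / (5 / 2) : ℝ) = 10 ^ 7 := by
    rw [← Real.rpow_natCast, ← Real.rpow_mul (by norm_num), ← Real.rpow_natCast]
    norm_num
  have h2 : (2 : ℝ) ^ (7 / 2 : ℝ) ≤ 11.4 := by
    rw [show (7 / 2 : ℝ) = 7 * (1 / 2) by norm_num, Real.rpow_mul (by norm_num),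
      ← Real.sqrt_eq_rpow]
    refine Real.sqrt_le_iff.2 ⟨by norm_num, ?_⟩
    norm_num
  rw [e]
  generalize (2 : ℝ) ^ (7 / 2 : ℝ) = y at h2 ⊢
  rw [show y * 10 ^ 7 * (5 / 2) / (5 / 2 - 1) = y * 10 ^ 7 * (5 / 3) by norm_num; ring]
  linarith

/-- The subtracted term is designed to telescope: after `log (p/(p-1)) ≤ 1/(p-1)` and division by `p
+ 1`, the new error `1/((p-1)(p+1))` is half the difference of `1/(p-1)` and `1/(p+1)`, so the
induction closes with equality. -/
theorem exists_decayBound_half_integer {f : ℝ → ℝ} (hf : SelfConvolutive f)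
    (h : DecayBound f (1 / 2) 2) (k : ℕ) :
    ∃ C, 0 < C ∧ DecayBound f (k + 5 / 2) C ∧ Real.log C ≤ (k + 5 / 2) *
      ((k + 5 / 2 + 5) * Real.log 2 - (1 / (k + 5 / 2 - 1) + 1 / (k + 5 / 2)) / 2) := by
  induction k with
  | zero =>
    refine ⟨10 ^ 5, by norm_num, by simpa using hf.decayBound_five_halves h, ?_⟩
    have h10 : Real.log 10 = Real.log 2 + Real.log 5 := by
      rw [← Real.log_mul (by norm_num) (by norm_num)]; norm_num
    have h5 : 3 * Real.log 5 ≤ 7 * Real.log 2 := by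
      have := Real.log_le_log (by norm_num) (show (5 : ℝ) ^ 3 ≤ 2 ^ 7 by norm_num)
      rw [Real.log_pow, Real.log_pow] at this
      exact_mod_cast this
    have := Real.log_two_gt_d9
    rw [Real.log_pow, h10]
    norm_num
    linarith
  | succ k ih =>
    obtain ⟨C, hC, hd, hlog⟩ := ih
    have hp1 : (1 : ℝ) < k + 5 / 2 := by
      have : (0 : ℝ) ≤ k := k.cast_nonneg
      linarith
    have e : ((k + 1 : ℕ) : ℝ) + 5 / 2 = k + 5 / 2 + 1 := by push_cast; ring
    rw [e]
    set p : ℝ := k + 5 / 2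
    have hp0 : 0 < p := one_pos.trans hp1
    have hp1' : 0 < p - 1 := sub_pos.2 hp1
    refine ⟨_, ?_, hf.decayBound_add_one hp1 hC hd, ?_⟩
    · positivity
    have hratio : Real.log (p / (p - 1)) ≤ 1 / (p - 1) := by
      refine (Real.log_le_sub_one_of_pos (by positivity)).trans (le_of_eq ?_)
      field_simp
      ring
    rw [mul_div_assoc, Real.log_mul (by positivity) (by positivity),
      Real.log_mul (by positivity) (by positivity), Real.log_rpow two_pos, Real.log_rpow hC]
    have h1 : (1 + 1 / p) * Real.log C ≤ (1 + 1 / p) *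
      (p * ((p + 5) * Real.log 2 - (1 / (p - 1) + 1 / p) / 2)) :=
      mul_le_mul_of_nonneg_left hlog (by positivity)
    refine (add_le_add (add_le_add le_rfl h1) hratio).trans (le_of_eq ?_)
    have : p + 1 - 1 ≠ 0 := by rw [add_sub_cancel_right]; exact hp0.ne'
    field_simp
    ring

theorem SelfConvolutive.decayBound_two_rpow {f : ℝ → ℝ} (hf : SelfConvolutive f)
    (h : DecayBound f (1 / 2) 2) {p : ℝ} (hp : 0 < p) :
    DecayBound f p (2 ^ (p ^ 2 + 6 * p)) := by
  rcases le_or_gt p (3 / 2) with hp2 | hp2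
  · obtain ⟨C, hC, h3⟩ := hf.exists_decayBound_three_halves h
    -- The exponent `9 = 6 * (3/2)` interpolates to `2^(6p)`.
    have h512 : DecayBound f (3 / 2) (2 ^ (9 : ℝ)) := h3.mono (hC.le.trans (by norm_num))
    refine (h512.of_le hf.nonneg hf.le_one hp hp2 (by positivity)).mono ?_
    rw [← Real.rpow_mul two_pos.le]
    refine Real.rpow_le_rpow_of_exponent_le one_le_two ?_
    nlinarith
  -- The half-integer `q = k + 5/2` satisfies `p ≤ q < p + 1`, so `q + 5 < p + 6` and the correction
  -- term can be dropped. For `p ≤ 5/2` the natural ceiling is 0.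
  · set k := ⌈p - 5 / 2⌉₊ with hk
    have hle : p ≤ k + 5 / 2 := by
      have := Nat.le_ceil (p - 5 / 2)
      linarith
    have hlt : k + 5 / 2 < p + 1 := by
      rcases le_or_gt p (5 / 2) with h' | h'
      · rw [hk, Nat.ceil_eq_zero.2 (by linarith)]
        norm_num
        linarith
      · have := Nat.ceil_lt_add_one (sub_nonneg.2 h'.le)
        linarith
    obtain ⟨C, hC, hd, hlog⟩ := exists_decayBound_half_integer hf h k
    have hq1 : (0 : ℝ) < k + 5 / 2 - 1 := by
      have : (0 : ℝ) ≤ k := k.cast_nonneg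
      linarith
    set q : ℝ := k + 5 / 2
    have hq : 0 < q := by linarith
    refine (hd.of_le hf.nonneg hf.le_one hp hle hC.le).mono ?_
    rw [← Real.log_le_log_iff (by positivity) (by positivity), Real.log_rpow hC,
      Real.log_rpow two_pos]
    have hl2 : 0 < Real.log 2 := Real.log_pos one_lt_two
    have hc : 0 ≤ (1 / (q - 1) + 1 / q) / 2 := by positivity
    calc p / q * Real.log C ≤ p / q * (q * ((p + 6) * Real.log 2)) := by
          refine mul_le_mul_of_nonneg_left (hlog.trans ?_) (by positivity)
          refine mul_le_mul_of_nonneg_left ?_ hq.le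
          nlinarith
      _ = (p ^ 2 + 6 * p) * Real.log 2 := by
          field_simp

/-- The admissible constants form a closed set. One nonzero `t` with `φ t ≠ 0` bounds it below by a
positive number; `t = 0` would say nothing when `p > 0`. -/
theorem isLeast_csInf_decayConstants {φ : ℝ → ℂ} {p : ℝ} (hne : (decayConstants φ p).Nonempty)
    {t : ℝ} (ht : t ≠ 0) (hφt : 0 < ‖φ t‖) :
    0 < sInf (decayConstants φ p) ∧ IsLeast (decayConstants φ p) (sInf (decayConstants φ p)) := by
  have hlb : ∀ C ∈ decayConstants φ p, ‖φ t‖ / |t| ^ (-p) ≤ C := fun C hC =>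
    (div_le_iff₀ (Real.rpow_pos_of_pos (abs_pos.2 ht) _)).2 (hC t (Or.inl ht))
  have hclosed : IsClosed (decayConstants φ p) := by
    simp only [decayConstants, Set.ofPred_forall]
    exact isClosed_iInter fun s => isClosed_iInter fun _ =>
      isClosed_le continuous_const (continuous_id.mul continuous_const)
  refine ⟨(div_pos hφt (Real.rpow_pos_of_pos (abs_pos.2 ht) _)).trans_le (le_csInf hne hlb),
    hclosed.csInf_mem hne ⟨_, hlb⟩, fun C hC => csInf_le ⟨_, hlb⟩ hC⟩

theorem mem_decayConstants_iff {μ : Measure ℝ} {p : ℝ} (hp : 0 < p) {C : ℝ} :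
    C ∈ decayConstants (charFun μ) p ↔ DecayBound (fun t => ‖charFun μ t‖) p C := by
  refine ⟨fun h t ht => by simpa [abs_of_pos ht] using h t (Or.inl ht.ne'), fun h t ht => ?_⟩
  have ht0 : t ≠ 0 := ht.resolve_right hp.ne'
  have hn : ‖charFun μ |t|‖ = ‖charFun μ t‖ := by
    rcases abs_choice t with h | h <;> rw [h]
    rw [charFun_neg, RCLike.norm_conj]
  rw [← hn]
  exact h _ (abs_pos.2 ht0)

end Quicksort

theorem theorem2p1 {Ω : Type*} [MeasurableSpace Ω] (P : Measure Ω) [IsProbabilityMeasure P]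
    (Y : Ω → ℝ) (hY : Quicksort.IsLimit P Y) :
    ∃ c : ℝ → ℝ,
      (∀ p : ℝ, 0 ≤ p →
        0 < c p ∧ IsLeast (Quicksort.decayConstants (charFun (P.map Y)) p) (c p)) ∧
      c 0 = 1 ∧
      c (1 / 2) ≤ 2 ∧
      c (3 / 4) ≤ Real.sqrt (8 * Real.pi) ∧
      c 1 ≤ 4 * Real.pi ∧
      c (3 / 2) < 187 ∧
      c (5 / 2) < 103215 ∧
      c (7 / 2) < 197102280 ∧
      (∀ p₁ p₂ : ℝ, 0 < p₁ → p₁ ≤ p₂ → c p₁ ^ (1 / p₁) ≤ c p₂ ^ (1 / p₂)) ∧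
      (∀ p : ℝ, 1 < p →
        c (p + 1) ≤ 2 ^ (p + 1) * c p ^ (1 + 1 / p) * p / (p - 1)) ∧
      (∀ p : ℝ, 0 < p → c p ≤ 2 ^ (p ^ 2 + 6 * p)) := by
  have hμ := Measure.isProbabilityMeasure_map (μ := P) hY.aemeasurable_limit
  have hf := hY.selfConvolutive
  have h2 : Quicksort.DecayBound (fun t => ‖charFun (P.map Y) t‖) (1 / 2) 2 :=
    fun t ht => hY.norm_charFun_le_of_pos ht
  -- Continuity at 0, where the characteristic function equals 1.
  obtain ⟨t, ht0, ht⟩ : ∃ t : ℝ, t ≠ 0 ∧ 0 < ‖charFun (P.map Y) t‖ := by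
    have h0 : 0 < ‖charFun (P.map Y) 0‖ := by simp
    have h1 := tendsto_nhdsWithin_of_tendsto_nhds (s := {0}ᶜ) (hf.continuous.tendsto 0)
    obtain ⟨t, ht, ht'⟩ := ((h1.eventually (lt_mem_nhds h0)).and self_mem_nhdsWithin).exists
    exact ⟨t, ht', ht⟩
  have hone : (1 : ℝ) ∈ Quicksort.decayConstants (charFun (P.map Y)) 0 := fun s _ => by
    simpa using norm_charFun_le_one s
  set c : ℝ → ℝ := fun p => sInf (Quicksort.decayConstants (charFun (P.map Y)) p)
  have hc (p : ℝ) (hp : 0 ≤ p) :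
      0 < c p ∧ IsLeast (Quicksort.decayConstants (charFun (P.map Y)) p) (c p) := by
    refine Quicksort.isLeast_csInf_decayConstants ?_ ht0 ht
    rcases hp.eq_or_lt with rfl | hp
    · exact ⟨1, hone⟩
    · exact ⟨_, (Quicksort.mem_decayConstants_iff hp).2 (hf.decayBound_two_rpow h2 hp)⟩
  have hcle {p C : ℝ} (hp : 0 < p)
      (h : Quicksort.DecayBound (fun t => ‖charFun (P.map Y) t‖) p C) : c p ≤ C :=
    (hc p hp.le).2.2 ((Quicksort.mem_decayConstants_iff hp).2 h)
  have hbound {p : ℝ} (hp : 0 < p) :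
      Quicksort.DecayBound (fun t => ‖charFun (P.map Y) t‖) p (c p) :=
    (Quicksort.mem_decayConstants_iff hp).1 (hc p hp.le).2.1
  refine ⟨c, hc, le_antisymm ((hc 0 le_rfl).2.2 hone) ?_, hcle (by norm_num) h2,
    hcle (by norm_num) (hf.decayBound_three_quarters h2),
    hcle one_pos (hf.decayBound_one h2), ?_,
    (hcle (by norm_num) (hf.decayBound_five_halves h2)).trans_lt (by norm_num),
    (hcle (by norm_num) (hf.decayBound_seven_halves h2)).trans_lt (by norm_num), ?_, ?_,
    fun p hp => hcle hp (hf.decayBound_two_rpow h2 hp)⟩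
  -- For `p = 0` the constraint at `t = 0` is active and forces `1 ≤ c 0`.
  · simpa using (hc 0 le_rfl).2.1 0 (Or.inr rfl)
  · obtain ⟨C, hC, h3⟩ := hf.exists_decayBound_three_halves h2
    exact (hcle (by norm_num) h3).trans_lt hC
  · intro p₁ p₂ hp₁ hp
    have hp₂ : 0 < p₂ := hp₁.trans_le hp
    have hpos₂ := (hc p₂ hp₂.le).1.le
    have h := hcle hp₁ ((hbound hp₂).of_le hf.nonneg hf.le_one hp₁ hp hpos₂)
    refine (Real.rpow_le_rpow (hc p₁ hp₁.le).1.le h (by positivity)).trans (le_of_eq ?_)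
    rw [← Real.rpow_mul hpos₂]
    congr 1
    field_simp
  · intro p hp
    have hp0 : 0 < p := one_pos.trans hp
    exact hcle (by linarith) (hf.decayBound_add_one hp (hc p hp0.le).1 (hbound hp0))
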